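/- Let $\mathbb{D}=\{z\in\mathbb{C}:|z|<1\}$. Let $\widehat{\mathcal D}$ be the set of finite positive Borel measures $\omega$ on $[0,1)$ for which there is a constant $C=C(\omega)>0$ with $\omega([r,1))\le C\,\omega\big([\tfrac{1+r}{2},1)\big)$ for all $0\le r<1$. For such $\omega$, let $\omega\otimes m$ be the measure on $\mathbb{D}$ given by $d(\omega\otimes m)(re^{i\theta})=r\,d\omega(r)\,d\theta$, and let $A^2_\omega$ be the space of analytic functions $f$ in $\mathbb{D}$ with $\int_{\mathbb{D}}|f|^2\,d(\omega\otimes m)<\infty$. The Bergman reproducing kernel of $A^2_\omega$ is the unique family $B^\omega_z\in A^2_\omega$, $z\in\mathbb{D}$, such that $f(z)=\int_{\mathbb{D}}f(\zeta)\overline{B^\omega_z(\zeta)}\,d(\omega\otimes m)(\zeta)$ for all $f\in A^2_\omega$ and $z\in\mathbb{D}$, whenever such a family exists. **Theorem.** Let $\nu$ be a finite positive Borel measure supported on $[0,1]$ such that $\int_0^1\frac{d\nu(r)}{1-r}=\infty$ (where $\frac1{1-r}=\infty$ at $r=1$). Then there exists $\omega\in\widehat{\mathcal D}$ whose Bergman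 reproducing kernel exists and is given by $$B^\omega_z(\zeta)=\frac{1}{1-\overline z\zeta}\int_0^1\frac{d\nu(r)}{1-r\overline z\zeta},\qquad z,\zeta\in\mathbb{D}.$$ -/

import Mathlib

open MeasureTheory Set
open scoped ENNReal NNReal ComplexConjugate

noncomputable section

namespace RadialBergman

/-- The class of (finite) positive Borel measures `ω` on `[0,1)` whose tail `ω([r,1))` satisfies
the doubling condition `ω([r,1)) ≤ C ω([(1+r)/2,1))` for all `0 ≤ r < 1`. A measure on `[0,1)` is
represented by a measure on `ℝ` which does not charge the complement of `[0,1)`. -/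
def doublingMeasures : Set (Measure ℝ) :=
  {ω | IsFiniteMeasure ω ∧ ω (Ico (0 : ℝ) 1)ᶜ = 0 ∧
    ∃ C : ℝ≥0, 0 < C ∧
      ∀ r ∈ Ico (0 : ℝ) 1, ω (Ico r 1) ≤ (C : ℝ≥0∞) * ω (Ico ((1 + r) / 2) 1)}

/-- The measure `ω ⊗ m` on the unit disc, given in polar coordinates by
`d(ω ⊗ m)(r e^{iθ}) = r dω(r) dθ`. -/
def discMeasure (ω : Measure ℝ) : Measure ℂ :=
  Measure.map (fun p : ℝ × ℝ => (p.1 : ℂ) * Complex.exp ((p.2 : ℂ) * Complex.I))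
    ((ω.withDensity fun r => ENNReal.ofReal r).prod (volume.restrict (Ioc 0 (2 * Real.pi))))

/-- The weighted Bergman space `A^p_ω`: functions analytic in the unit disc such that `|f|^p` has
finite integral over the disc with respect to `ω ⊗ m`. -/
def bergmanSpace (p : ℝ) (ω : Measure ℝ) : Set (ℂ → ℂ) :=
  {f | DifferentiableOn ℂ f (Metric.ball 0 1) ∧
    ∫⁻ ζ in Metric.ball (0 : ℂ) 1, ‖f ζ‖ₑ ^ p ∂(discMeasure ω) < ∞}

/-- `B` is the Bergman reproducing kernel of `A^2_ω`: for each `z` in the unit disc, `B z` lies in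
`A^2_ω` and `f(z) = ⟨f, B z⟩` for every `f` in `A^2_ω`. -/
def IsBergmanKernel (ω : Measure ℝ) (B : ℂ → ℂ → ℂ) : Prop :=
  ∀ z ∈ Metric.ball (0 : ℂ) 1, B z ∈ bergmanSpace 2 ω ∧
    ∀ f ∈ bergmanSpace 2 ω,
      f z = ∫ ζ in Metric.ball (0 : ℂ) 1, f ζ * conj (B z ζ) ∂(discMeasure ω)

/-- The reproducing kernel is unique, so the predicate above determines it on the disc. -/
theorem IsBergmanKernel.unique {ω : Measure ℝ} {B B' : ℂ → ℂ → ℂ}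
    (hB : IsBergmanKernel ω B) (hB' : IsBergmanKernel ω B') {z ζ : ℂ}
    (hz : z ∈ Metric.ball (0 : ℂ) 1) (hζ : ζ ∈ Metric.ball (0 : ℂ) 1) : B z ζ = B' z ζ := by
  have key : ∀ K L : ℂ → ℂ → ℂ, IsBergmanKernel ω K → IsBergmanKernel ω L →
      K z ζ = conj (L ζ z) := by
    intro K L hK hL
    rw [(hL ζ hζ).2 (K z) (hK z hz).1, (hK z hz).2 (L ζ) (hL ζ hζ).1, ← integral_conj]
    refine integral_congr_ae (Filter.Eventually.of_forall fun w => ?_)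
    simp [mul_comm]
  rw [key B B' hB hB', key B' B' hB' hB']

end RadialBergman

end

/-! Write `ν_k` for the moments of `ν` and `S_n = ν_0 + ... + ν_n`. Multiplying two geometric
series, the proposed kernel is `∑ S_n (conj z * ζ)^n`. For a radial weight the monomials are
orthogonal, and the squared norm of `ζ^n` is `2π ∫ x^(2n+1) dω`. So the task is to find a doubling
`ω` whose odd moments are `1 / (2π S_n)`.

To prescribe all moments, interpolate `S`: with `c_k = ∫ √x^k / (1 + √x) dν`, the sums `a_m = c_0 +
... + c_m` satisfy `a_(2n+1) = S_n`, because `√x^(2k) + √x^(2k+1) = x^k (1 + √x)`. The increments of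
`a` are again moments, hence completely monotone, and the Leibniz rule then makes `1 / a` completely
monotone (`IsCompletelyMonotone.inv`). Hausdorff's moment theorem, proved here with Bernstein
weights and weak compactness, yields a measure on `[0, 1]` with moments `1 / a_m`. Divergence of `∫
dν / (1 - r)` means `S_n → ∞`, which excludes an atom at `1`. Since `c` is decreasing, `a` grows at
most linearly under dilation of the index; this slow decay of the moments of `ω` gives doubling
(`mem_doublingMeasures_of_moments`). -/

/-! ### Finite differences and completely monotone sequences. -/

/-- The backward difference operator `(D b)(n) = b n - b (n + 1)` on real sequences. -/
def negDiff (b : ℕ → ℝ) : ℕ → ℝ := fun n => b n - b (n + 1)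

/-- A completely monotone sequence: all iterated differences `negDiff^[k] b` are nonnegative. -/
def IsCompletelyMonotone (b : ℕ → ℝ) : Prop := ∀ k n, 0 ≤ negDiff^[k] b n

theorem negDiff_iterate_add (k : ℕ) (a b : ℕ → ℝ) :
    negDiff^[k] (a + b) = negDiff^[k] a + negDiff^[k] b := by
  induction k generalizing a b with
  | zero => rfl
  | succ k ih =>
    have : negDiff (a + b) = negDiff a + negDiff b := by
      ext n; simp only [negDiff, Pi.add_apply]; ring
    rw [Function.iterate_succ_apply, Function.iterate_succ_apply, Function.iterate_succ_apply,
      this, ih]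

theorem negDiff_iterate_neg (k : ℕ) (a : ℕ → ℝ) : negDiff^[k] (-a) = -negDiff^[k] a := by
  induction k generalizing a with
  | zero => rfl
  | succ k ih =>
    have : negDiff (-a) = -negDiff a := by
      ext n; simp only [negDiff, Pi.neg_apply]; ring
    rw [Function.iterate_succ_apply, Function.iterate_succ_apply, this, ih]

theorem negDiff_iterate_shift (k : ℕ) (a : ℕ → ℝ) (m : ℕ) :
    negDiff^[k] (fun n => a (n + m)) = fun n => negDiff^[k] a (n + m) := by
  induction k generalizing a with
  | zero => rfl
  | succ k ih =>
    have : negDiff (fun n => a (n + m)) = fun n => negDiff a (n + m) := by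
      ext n; simp only [negDiff, add_right_comm]
    rw [Function.iterate_succ_apply, Function.iterate_succ_apply, this, ih]

theorem negDiff_iterate_zero (k : ℕ) : negDiff^[k] 0 = 0 := by
  induction k with
  | zero => rfl
  | succ k ih =>
    rw [Function.iterate_succ_apply']
    rw [ih]; ext n; simp [negDiff]

/-- The Leibniz rule for iterated differences. -/
theorem negDiff_iterate_mul (k : ℕ) (a b : ℕ → ℝ) (n : ℕ) :
    negDiff^[k] (a * b) n = ∑ p ∈ Finset.HasAntidiagonal.antidiagonal k,
      (k.choose p.1 : ℝ) * (negDiff^[p.1] a n * negDiff^[p.2] b (n + p.1)) := by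
  induction k generalizing a b with
  | zero => simp
  | succ k ih =>
    have h : negDiff (a * b) = a * negDiff b + negDiff a * fun n => b (n + 1) := by
      ext n; simp only [negDiff, Pi.mul_apply, Pi.add_apply]; ring
    rw [Function.iterate_succ_apply, h, negDiff_iterate_add, Pi.add_apply, ih, ih,
      Finset.sum_antidiagonal_choose_succ_mul
        (fun i j => negDiff^[i] a n * negDiff^[j] b (n + i)) k]
    congr 1
    refine Finset.sum_congr rfl fun p hp => ?_
    rw [negDiff_iterate_shift, ← Nat.choose_symm_of_eq_add (Finset.HasAntidiagonal.mem_antidiagonal.1 hp).symm]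
    simp only [Function.iterate_succ_apply, add_assoc]

/-- If the increments of the positive sequence `a` are completely monotone, then so is `1 / a`. -/
theorem IsCompletelyMonotone.inv {a : ℕ → ℝ} (ha : ∀ n, 0 < a n)
    (h : IsCompletelyMonotone fun n => a (n + 1) - a n) : IsCompletelyMonotone a⁻¹ := by
  have hD : ∀ k n, negDiff^[k + 1] a n ≤ 0 := fun k n => by
    have e : negDiff a = -fun n => a (n + 1) - a n := by ext n; simp [negDiff]
    rw [Function.iterate_succ_apply, e, negDiff_iterate_neg]
    exact neg_nonpos.2 (h k n)
  intro k
  induction k using Nat.strong_induction_on with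
  | _ k ih =>
    intro n
    rcases k with _ | k
    · exact (inv_pos.2 (ha n)).le
    have h1 : a * a⁻¹ = fun _ => 1 := by
      ext m; exact mul_inv_cancel₀ (ha m).ne'
    have h0 : negDiff^[k + 1] (a * a⁻¹) n = 0 := by
      have : negDiff (a * a⁻¹) = 0 := by rw [h1]; ext m; simp [negDiff]
      rw [Function.iterate_succ_apply, this, negDiff_iterate_zero]; rfl
    -- Isolate the Leibniz term in which no difference falls on `a`. Every other term pairs a
    -- nonpositive difference of `a` with a lower-order difference of `a⁻¹`, nonnegative by
    -- induction, so the isolated term must be nonnegative.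
    rw [negDiff_iterate_mul, Finset.Nat.sum_antidiagonal_succ] at h0
    have h2 : ∑ p ∈ Finset.HasAntidiagonal.antidiagonal k, ((k + 1).choose (p.1 + 1) : ℝ) *
        (negDiff^[p.1 + 1] a n * negDiff^[p.2] a⁻¹ (n + (p.1 + 1))) ≤ 0 := by
      refine Finset.sum_nonpos fun p hp => ?_
      refine mul_nonpos_of_nonneg_of_nonpos (Nat.cast_nonneg _)
        (mul_nonpos_of_nonpos_of_nonneg (hD _ _) (ih _ ?_ _))
      have := Finset.HasAntidiagonal.mem_antidiagonal.1 hp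
      omega
    simp only [Nat.choose_zero_right, Nat.cast_one, one_mul, Function.iterate_zero, id, add_zero]
      at h0
    exact nonneg_of_mul_nonneg_right (by linarith) (ha n)

/-! ### Hausdorff's moment theorem by Bernstein weights. -/

/-- For `b n = ∫ x^n dμ` this integrates the binomial identity `∑ C(N,j) C(j,m) x^j (1-x)^(N-j) =
C(N,m) x^m`. For arbitrary `b` it follows from Pascal's rule applied to both binomial factors. -/
theorem sum_choose_mul_choose_mul_negDiff (N m : ℕ) (b : ℕ → ℝ) :
    ∑ p ∈ Finset.HasAntidiagonal.antidiagonal N, (N.choose p.1 : ℝ) * (p.1.choose m * negDiff^[p.2] b p.1) =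
      N.choose m * b m := by
  induction N generalizing m b with
  | zero => rcases m with _ | m <;> simp
  | succ N ih =>
    rw [Finset.sum_antidiagonal_choose_succ_mul
        (fun i j => (i.choose m : ℝ) * negDiff^[j] b i) N]
    have e2 : ∀ l, ∑ p ∈ Finset.HasAntidiagonal.antidiagonal N,
        (N.choose p.2 : ℝ) * (p.1.choose l * negDiff^[p.2] b (p.1 + 1)) =
        N.choose l * b (l + 1) := fun l => by
      rw [← ih l fun n => b (n + 1)]
      refine Finset.sum_congr rfl fun p hp => ?_
      rw [negDiff_iterate_shift, ← Nat.choose_symm_of_eq_add (Finset.HasAntidiagonal.mem_antidiagonal.1 hp).symm]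
    have e1 : ∀ l, ∑ p ∈ Finset.HasAntidiagonal.antidiagonal N,
        (N.choose p.1 : ℝ) * (p.1.choose l * negDiff^[p.2 + 1] b p.1) =
        N.choose l * (b l - b (l + 1)) := fun l => ih l (negDiff b)
    rw [e1]
    rcases m with _ | m
    · have := e2 0
      simp only [Nat.choose_zero_right, Nat.cast_one, one_mul] at this ⊢
      rw [this]; ring
    · have : ∀ p ∈ Finset.HasAntidiagonal.antidiagonal N, (N.choose p.2 : ℝ) *
          ((p.1 + 1).choose (m + 1) * negDiff^[p.2] b (p.1 + 1)) =
          (N.choose p.2 : ℝ) * (p.1.choose m * negDiff^[p.2] b (p.1 + 1)) +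
          (N.choose p.2 : ℝ) * (p.1.choose (m + 1) * negDiff^[p.2] b (p.1 + 1)) := by
        intro p _
        rw [Nat.choose_succ_succ]; push_cast; ring
      rw [Finset.sum_congr rfl this, Finset.sum_add_distrib, e2, e2, Nat.choose_succ_succ]
      push_cast; ring

/-- Bernstein weights have exact factorial moments; this bounds the cost, of relative order `1 / N`,
of replacing them by power moments. -/
theorem mul_pow_sub_descFactorial_le {j N : ℕ} (h : j ≤ N) (m : ℕ) :
    (N : ℝ) * ((j : ℝ) ^ m - j.descFactorial m) ≤ m ^ 2 * (N : ℝ) ^ m := by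
  induction m with
  | zero => simp
  | succ m ih =>
    have hd : (j.descFactorial (m + 1) : ℝ) = (j - m) * j.descFactorial m := by
      rw [Nat.descFactorial_succ]
      rcases le_or_gt m j with hm | hm
      · push_cast [hm]; ring
      · simp [Nat.descFactorial_of_lt hm]
    have h1 : (j.descFactorial m : ℝ) ≤ (j : ℝ) ^ m := mod_cast Nat.descFactorial_le_pow j m
    have h2 : (j : ℝ) ≤ N := mod_cast h
    have h3 : (j : ℝ) ^ m ≤ (N : ℝ) ^ m := by gcongr
    have h4 : (j : ℝ) * (N * ((j : ℝ) ^ m - j.descFactorial m)) ≤ N * (m ^ 2 * (N : ℝ) ^ m) := by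
      refine mul_le_mul h2 ih ?_ (Nat.cast_nonneg _)
      exact mul_nonneg (Nat.cast_nonneg _) (sub_nonneg.2 h1)
    have h5 : (N : ℝ) * (m * j.descFactorial m) ≤ N * (m * (N : ℝ) ^ m) := by
      gcongr; exact h1.trans h3
    have h6 : (0 : ℝ) ≤ (m + 1) * (N * (N : ℝ) ^ m) := by positivity
    rw [hd, pow_succ (j : ℝ) m, pow_succ (N : ℝ) m]
    push_cast
    nlinarith

/-- The weight which the `N`-th Bernstein operator attaches to the node `p.1 / N`. -/
noncomputable def bernsteinWeight (b : ℕ → ℝ) (N : ℕ) (p : ℕ × ℕ) : ℝ :=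
  N.choose p.1 * negDiff^[p.2] b p.1

theorem bernsteinWeight_nonneg {b : ℕ → ℝ} (hb : IsCompletelyMonotone b) (N : ℕ) (p : ℕ × ℕ) :
    0 ≤ bernsteinWeight b N p :=
  mul_nonneg (Nat.cast_nonneg _) (hb _ _)

theorem sum_bernsteinWeight (b : ℕ → ℝ) (N : ℕ) :
    ∑ p ∈ Finset.HasAntidiagonal.antidiagonal N, bernsteinWeight b N p = b 0 := by
  simpa [bernsteinWeight] using sum_choose_mul_choose_mul_negDiff N 0 b

theorem sum_bernsteinWeight_mul_descFactorial (b : ℕ → ℝ) (N m : ℕ) :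
    ∑ p ∈ Finset.HasAntidiagonal.antidiagonal N, bernsteinWeight b N p * p.1.descFactorial m =
      N.descFactorial m * b m := by
  have := congrArg ((m.factorial : ℝ) * ·) (sum_choose_mul_choose_mul_negDiff N m b)
  simp only [Finset.mul_sum] at this
  rw [Nat.descFactorial_eq_factorial_mul_choose]
  push_cast
  rw [mul_assoc, ← this]
  refine Finset.sum_congr rfl fun p _ => ?_
  rw [bernsteinWeight, Nat.descFactorial_eq_factorial_mul_choose]
  push_cast; ring

theorem div_pow_sub_descFactorial_mem {j N : ℕ} (h : j ≤ N) (hN : 0 < N) (m : ℕ) :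
    ((j : ℝ) / N) ^ m - j.descFactorial m / (N : ℝ) ^ m ∈ Icc (0 : ℝ) (m ^ 2 / N) := by
  have hN' : (0 : ℝ) < N := mod_cast hN
  have h1 : (j.descFactorial m : ℝ) ≤ (j : ℝ) ^ m := mod_cast Nat.descFactorial_le_pow j m
  rw [div_pow, ← sub_div]
  refine ⟨div_nonneg (sub_nonneg.2 h1) (by positivity), ?_⟩
  rw [div_le_div_iff₀ (by positivity) hN', mul_comm]
  exact mul_pow_sub_descFactorial_le h m

/-- Two errors add up: replacing falling factorials by powers at the nodes costs at most `b 0 * m ^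
2 / N`, and replacing `N.descFactorial m / N ^ m` by `1` costs at most `b m * m ^ 2 / N`. -/
theorem abs_sum_bernsteinWeight_mul_pow_sub_le {b : ℕ → ℝ} (hb : IsCompletelyMonotone b)
    {N : ℕ} (hN : 0 < N) (m : ℕ) :
    |∑ p ∈ Finset.HasAntidiagonal.antidiagonal N, bernsteinWeight b N p * ((p.1 : ℝ) / N) ^ m - b m|
      ≤ (b 0 + b m) * m ^ 2 / N := by
  have hN' : (0 : ℝ) < N := mod_cast hN
  have hsum : ∑ p ∈ Finset.HasAntidiagonal.antidiagonal N,
      bernsteinWeight b N p * (((p.1 : ℝ) / N) ^ m - p.1.descFactorial m / (N : ℝ) ^ m) =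
      ∑ p ∈ Finset.HasAntidiagonal.antidiagonal N, bernsteinWeight b N p * ((p.1 : ℝ) / N) ^ m -
        N.descFactorial m / (N : ℝ) ^ m * b m := by
    rw [div_mul_eq_mul_div, ← sum_bernsteinWeight_mul_descFactorial, Finset.sum_div,
      ← Finset.sum_sub_distrib]
    exact Finset.sum_congr rfl fun p _ => by ring
  have hle : ∀ p ∈ Finset.HasAntidiagonal.antidiagonal N, p.1 ≤ N := fun p hp => by
    have := Finset.HasAntidiagonal.mem_antidiagonal.1 hp
    omega
  have hlow : 0 ≤ ∑ p ∈ Finset.HasAntidiagonal.antidiagonal N,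
      bernsteinWeight b N p * (((p.1 : ℝ) / N) ^ m - p.1.descFactorial m / (N : ℝ) ^ m) :=
    Finset.sum_nonneg fun p hp => mul_nonneg (bernsteinWeight_nonneg hb _ _)
      (div_pow_sub_descFactorial_mem (hle p hp) hN m).1
  have hup : ∑ p ∈ Finset.HasAntidiagonal.antidiagonal N,
      bernsteinWeight b N p * (((p.1 : ℝ) / N) ^ m - p.1.descFactorial m / (N : ℝ) ^ m) ≤
      b 0 * (m ^ 2 / N) := by
    rw [← sum_bernsteinWeight b N, Finset.sum_mul]
    exact Finset.sum_le_sum fun p hp => mul_le_mul_of_nonneg_left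
      (div_pow_sub_descFactorial_mem (hle p hp) hN m).2 (bernsteinWeight_nonneg hb _ _)
  obtain ⟨h1, h2⟩ := div_pow_sub_descFactorial_mem le_rfl hN m
  rw [div_self hN'.ne', one_pow] at h1 h2
  have hm : 0 ≤ b m := hb 0 m
  have h3 := mul_nonneg h1 hm
  have h4 := mul_le_mul_of_nonneg_right h2 hm
  have h5 : 0 ≤ b 0 * ((m : ℝ) ^ 2 / N) := mul_nonneg (hb 0 0) (by positivity)
  have h6 : (b 0 + b m) * (m : ℝ) ^ 2 / N = b 0 * (m ^ 2 / N) + m ^ 2 / N * b m := by ring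
  rw [hsum] at hlow hup
  rw [h6, abs_le]
  constructor <;> nlinarith

theorem tendsto_sum_bernsteinWeight_mul_pow {b : ℕ → ℝ} (hb : IsCompletelyMonotone b) (m : ℕ) :
    Filter.Tendsto (fun N : ℕ => ∑ p ∈ Finset.HasAntidiagonal.antidiagonal N,
      bernsteinWeight b N p * ((p.1 : ℝ) / N) ^ m) Filter.atTop (nhds (b m)) := by
  rw [tendsto_iff_norm_sub_tendsto_zero]
  refine squeeze_zero' (.of_forall fun _ => norm_nonneg _) ?_
    (tendsto_const_div_atTop_nhds_zero_nat ((b 0 + b m) * (m : ℝ) ^ 2))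
  filter_upwards [Filter.eventually_gt_atTop 0] with N hN
  exact abs_sum_bernsteinWeight_mul_pow_sub_le hb hN m

/-- The discrete measure carrying the Bernstein weights of a sequence. -/
noncomputable def bernsteinMeasure (b : ℕ → ℝ) (N : ℕ) : Measure (Icc (0 : ℝ) 1) :=
  ∑ p ∈ Finset.HasAntidiagonal.antidiagonal N, ENNReal.ofReal (bernsteinWeight b N p) •
    Measure.dirac (Set.projIcc 0 1 zero_le_one ((p.1 : ℝ) / N))

instance (b : ℕ → ℝ) (N : ℕ) : IsFiniteMeasure (bernsteinMeasure b N) := by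
  refine ⟨?_⟩
  simp [bernsteinMeasure, Measure.finsetSum_apply]

theorem bernsteinMeasure_univ {b : ℕ → ℝ} (hb : IsCompletelyMonotone b) (N : ℕ) :
    bernsteinMeasure b N univ = ENNReal.ofReal (b 0) := by
  rw [← sum_bernsteinWeight b N,
    ENNReal.ofReal_sum_of_nonneg fun p _ => bernsteinWeight_nonneg hb N p]
  simp [bernsteinMeasure, Measure.finsetSum_apply]

theorem integral_pow_bernsteinMeasure {b : ℕ → ℝ} (hb : IsCompletelyMonotone b) (N m : ℕ) :
    ∫ x, (x : ℝ) ^ m ∂(bernsteinMeasure b N) =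
      ∑ p ∈ Finset.HasAntidiagonal.antidiagonal N,
        bernsteinWeight b N p * ((p.1 : ℝ) / N) ^ m := by
  have hint : ∀ μ : Measure (Icc (0 : ℝ) 1), IsFiniteMeasure μ →
      Integrable (fun x : Icc (0 : ℝ) 1 => (x : ℝ) ^ m) μ := fun μ _ =>
    (BoundedContinuousFunction.mkOfCompact
      ⟨fun x : Icc (0 : ℝ) 1 => (x : ℝ) ^ m, by fun_prop⟩).integrable μ
  rw [bernsteinMeasure, integral_finsetSum_measure fun p _ =>
    (hint _ inferInstance).smul_measure ENNReal.ofReal_ne_top]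
  refine Finset.sum_congr rfl fun p hp => ?_
  have hle : (p.1 : ℝ) ≤ N := by
    have := Finset.HasAntidiagonal.mem_antidiagonal.1 hp
    exact_mod_cast (by omega : p.1 ≤ N)
  rw [integral_smul_measure, integral_dirac, ENNReal.toReal_ofReal (bernsteinWeight_nonneg hb _ _),
    Set.projIcc_of_mem zero_le_one (⟨by positivity, div_le_one_of_le₀ hle (by positivity)⟩ :
      (p.1 : ℝ) / N ∈ Icc (0 : ℝ) 1), smul_eq_mul]

/-- **Hausdorff's moment theorem**: a completely monotone sequence is the moment sequence of a
finite measure on the unit interval. -/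
theorem IsCompletelyMonotone.exists_measure {b : ℕ → ℝ} (hb : IsCompletelyMonotone b) :
    ∃ μ : Measure (Icc (0 : ℝ) 1), IsFiniteMeasure μ ∧ ∀ n : ℕ, ∫ x, (x : ℝ) ^ n ∂μ = b n := by
  let M : ℕ → FiniteMeasure (Icc (0 : ℝ) 1) := fun N => ⟨bernsteinMeasure b N, inferInstance⟩
  have hM : ∀ N, M N ∈ {μ : FiniteMeasure (Icc (0 : ℝ) 1) | μ.mass ≤ (b 0).toNNReal} := fun N => by
    have : ((M N).mass : ℝ≥0∞) = ENNReal.ofReal (b 0) := by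
      rw [FiniteMeasure.ennreal_mass]
      exact bernsteinMeasure_univ hb N
    exact (ENNReal.coe_inj.1 this).le
  -- The limit is taken along a free ultrafilter, so no subsequence has to be extracted; it is finer
  -- than `atTop`, so the moments still converge to `b`.
  obtain ⟨μ, -, hμ⟩ := (isCompact_setOfPred_finiteMeasure_le_of_compactSpace (Icc (0 : ℝ) 1)
    (b 0).toNNReal).ultrafilter_le_nhds ((Filter.hyperfilter ℕ).map M)
      (Filter.le_principal_iff.2 (Filter.mem_map.2 (Filter.univ_mem' hM)))
  refine ⟨μ, inferInstance, fun n => ?_⟩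
  have ht : Filter.Tendsto M (Filter.hyperfilter ℕ) (nhds μ) := hμ
  have h1 := FiniteMeasure.tendsto_iff_forall_integral_tendsto.1 ht
    (BoundedContinuousFunction.mkOfCompact
      ⟨fun x : Icc (0 : ℝ) 1 => (x : ℝ) ^ n, by fun_prop⟩)
  have h2 := (tendsto_sum_bernsteinWeight_mul_pow hb n).mono_left Nat.hyperfilter_le_atTop
  simp_rw [← integral_pow_bernsteinMeasure hb] at h2
  exact tendsto_nhds_unique h1 h2

/-- A version of Hausdorff's moment theorem for measures on the line. -/
theorem IsCompletelyMonotone.exists_measure_real {b : ℕ → ℝ} (hb : IsCompletelyMonotone b) :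
    ∃ μ : Measure ℝ, IsFiniteMeasure μ ∧ μ (Icc (0 : ℝ) 1)ᶜ = 0 ∧
      ∀ n : ℕ, ∫ x, x ^ n ∂μ = b n := by
  obtain ⟨μ, hμ, h⟩ := hb.exists_measure
  refine ⟨μ.map (↑), inferInstance, ?_, fun n => ?_⟩
  · rw [Measure.map_apply measurable_subtype_coe measurableSet_Icc.compl]
    simp
  · rw [integral_map measurable_subtype_coe.aemeasurable (by fun_prop), h n]

/-! ### From moment decay to the doubling condition. -/

theorem ae_mem_of_measure_compl_eq_zero {α : Type*} [MeasurableSpace α] {μ : Measure α}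
    {s : Set α} (h : μ sᶜ = 0) : ∀ᵐ x ∂μ, x ∈ s := by
  rwa [ae_iff]

theorem integrable_pow_of_measure_compl_Ico {ω : Measure ℝ} [IsFiniteMeasure ω]
    (h : ω (Ico (0 : ℝ) 1)ᶜ = 0) (n : ℕ) : Integrable (fun x : ℝ => x ^ n) ω := by
  refine Integrable.of_bound (by fun_prop) 1 ?_
  filter_upwards [ae_mem_of_measure_compl_eq_zero h] with x hx
  rw [norm_pow, Real.norm_of_nonneg hx.1]
  exact pow_le_one₀ hx.1 hx.2.le

/-- As `20 k + 19 = 19 (k + 1) + k`, the part of the higher moment below `ρ` is at most `(4/5)^19`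
times the `k`-th moment. Because `20 * (4/5)^19 < 1/2`, that part is absorbed on the left. -/
theorem integral_pow_le_of_doubling_moments {ω : Measure ℝ} [IsFiniteMeasure ω]
    (h : ω (Ico (0 : ℝ) 1)ᶜ = 0)
    (hW : ∀ k : ℕ, ∫ x, x ^ k ∂ω ≤ 20 * ∫ x, x ^ (20 * k + 19) ∂ω)
    {ρ : ℝ} {k : ℕ} (hk : ρ ^ (k + 1) ≤ 4 / 5) :
    ∫ x, x ^ k ∂ω ≤ 40 * ω.real (Ico ρ 1) := by
  have hint := integrable_pow_of_measure_compl_Ico h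
  have hI : Integrable ((Ico ρ 1).indicator (1 : ℝ → ℝ)) ω :=
    (integrable_const (1 : ℝ)).indicator measurableSet_Ico
  have h1 : ∫ x, x ^ (20 * k + 19) ∂ω ≤
      ω.real (Ico ρ 1) + (4 / 5) ^ 19 * ∫ x, x ^ k ∂ω := by
    rw [← integral_indicator_one measurableSet_Ico, ← integral_const_mul,
      ← integral_add hI ((hint k).const_mul _)]
    refine integral_mono_ae (hint _) (hI.add ((hint k).const_mul _)) ?_
    filter_upwards [ae_mem_of_measure_compl_eq_zero h] with x hx
    rcases le_or_gt ρ x with hx' | hx'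
    · simp only [indicator_of_mem (show x ∈ Ico ρ 1 from ⟨hx', hx.2⟩), Pi.one_apply]
      have := pow_le_one₀ (n := 20 * k + 19) hx.1 hx.2.le
      have := pow_nonneg hx.1 k
      have := mul_nonneg (by positivity : (0 : ℝ) ≤ (4 / 5) ^ 19) this
      linarith
    · have h2 : x ^ (k + 1) ≤ 4 / 5 := (pow_le_pow_left₀ hx.1 hx'.le _).trans hk
      have h3 : (x ^ (k + 1)) ^ 19 ≤ (4 / 5 : ℝ) ^ 19 :=
        pow_le_pow_left₀ (pow_nonneg hx.1 _) h2 _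
      have h4 : x ^ (20 * k + 19) = (x ^ (k + 1)) ^ 19 * x ^ k := by ring
      rw [indicator_of_notMem (fun hm => absurd hm.1 (not_le.2 hx')), zero_add, h4]
      exact mul_le_mul_of_nonneg_right h3 (pow_nonneg hx.1 k)
  have h2 := hW k
  have h3 : 0 ≤ ∫ x, x ^ k ∂ω := integral_nonneg_of_ae (by
    filter_upwards [ae_mem_of_measure_compl_eq_zero h] with x hx
    exact pow_nonneg hx.1 k)
  norm_num at h1
  linarith

/-- A measure on `[0, 1)` whose moments do not decay too quickly satisfies the doubling condition. -/
theorem mem_doublingMeasures_of_moments {ω : Measure ℝ} [IsFiniteMeasure ω]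
    (h : ω (Ico (0 : ℝ) 1)ᶜ = 0)
    (hW : ∀ k : ℕ, ∫ x, x ^ k ∂ω ≤ 20 * ∫ x, x ^ (20 * k + 19) ∂ω) :
    ω ∈ RadialBergman.doublingMeasures := by
  refine ⟨inferInstance, h, 80, by norm_num, fun r hr => ?_⟩
  have hint := integrable_pow_of_measure_compl_Ico h
  have hr1 : 0 < 1 - r := sub_pos.2 hr.2
  -- Take `k` about `1 / (2 (1 - r))`: large enough that `((1 + r) / 2) ^ (k + 1)` is at most `4/5`,
  -- small enough that `r ^ k` is at least `1/2`. Both are Bernoulli's inequality, the former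
  -- applied to `1 + s` with `s = (1 - r) / 2` and combined with `(1 - s) (1 + s) ≤ 1`.
  obtain ⟨k, hk1, hk2⟩ : ∃ k : ℕ, k * (1 - r) ≤ 1 / 2 ∧ 1 / 2 ≤ (k + 1 : ℝ) * (1 - r) := by
    refine ⟨⌊1 / 2 / (1 - r)⌋₊, ?_, ?_⟩
    · rw [← le_div_iff₀ hr1]
      exact Nat.floor_le (by positivity)
    · rw [← div_le_iff₀ hr1]
      exact (Nat.lt_floor_add_one _).le
  have hρ : (1 + r) / 2 ∈ Ico (0 : ℝ) 1 := ⟨by linarith [hr.1], by linarith [hr.2]⟩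
  have hpow : ((1 + r) / 2) ^ (k + 1) ≤ (4 / 5 : ℝ) := by
    have hb := one_add_mul_le_pow (a := (1 - r) / 2) (by linarith) (k + 1)
    have hle : ((1 + r) / 2) ^ (k + 1) * (1 + (1 - r) / 2) ^ (k + 1) ≤ (1 : ℝ) := by
      rw [← mul_pow]
      exact pow_le_one₀ (mul_nonneg hρ.1 (by linarith)) (by nlinarith)
    have h0 : 0 ≤ ((1 + r) / 2) ^ (k + 1) := pow_nonneg hρ.1 _
    push_cast at hb
    nlinarith
  have hrk : 1 / 2 ≤ r ^ k := by
    have hb := one_add_mul_le_pow (a := r - 1) (by linarith [hr.1]) k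
    rw [add_sub_cancel] at hb
    linarith
  have hlow : 1 / 2 * ω.real (Ico r 1) ≤ ∫ x, x ^ k ∂ω := by
    rw [← integral_indicator_one measurableSet_Ico, ← integral_const_mul]
    refine integral_mono_ae (((integrable_const (1 : ℝ)).indicator measurableSet_Ico).const_mul _)
      (hint k) ?_
    filter_upwards [ae_mem_of_measure_compl_eq_zero h] with x hx
    by_cases hm : x ∈ Ico r 1
    · simp only [indicator_of_mem hm, Pi.one_apply, mul_one]
      exact hrk.trans (pow_le_pow_left₀ hr.1 hm.1 k)
    · simp only [indicator_of_notMem hm, mul_zero]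
      exact pow_nonneg hx.1 k
  have hup := integral_pow_le_of_doubling_moments h hW hpow
  have hfin : ω.real (Ico r 1) ≤ 80 * ω.real (Ico ((1 + r) / 2) 1) := by linarith
  rw [← ofReal_measureReal, ← ofReal_measureReal (s := Ico ((1 + r) / 2) 1)]
  refine (ENNReal.ofReal_le_ofReal hfin).trans_eq ?_
  rw [ENNReal.ofReal_mul (by norm_num)]
  congr 1
  norm_num

/-! ### The interpolating sequence and the weight. -/

/-- The moments of the image under `√` of the measure `ν`, weighted by `1 / (1 + √x)`. -/
noncomputable def sqrtMoment (ν : Measure ℝ) (k : ℕ) : ℝ := ∫ x, √x ^ k / (1 + √x) ∂ν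

section

variable {ν : Measure ℝ} [IsFiniteMeasure ν]

theorem integrable_sqrt_pow_mul (hν : ν (Icc (0 : ℝ) 1)ᶜ = 0) (n j : ℕ) :
    Integrable (fun x => √x ^ n * (1 - √x) ^ j / (1 + √x)) ν := by
  refine Integrable.of_bound (Measurable.aestronglyMeasurable (by fun_prop)) 1 ?_
  filter_upwards [ae_mem_of_measure_compl_eq_zero hν] with x hx
  have h0 := Real.sqrt_nonneg x
  have h1 := Real.sqrt_le_one.2 hx.2
  have h2 : 0 ≤ √x ^ n * (1 - √x) ^ j := mul_nonneg (by positivity) (pow_nonneg (by linarith) _)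
  rw [Real.norm_of_nonneg (by positivity), div_le_one (by positivity)]
  exact (mul_le_one₀ (pow_le_one₀ h0 h1) (pow_nonneg (by linarith) _)
    (pow_le_one₀ (by linarith) (by linarith))).trans (by linarith)

theorem integrable_sqrt_pow (hν : ν (Icc (0 : ℝ) 1)ᶜ = 0) (n : ℕ) :
    Integrable (fun x => √x ^ n / (1 + √x)) ν := by
  simpa using integrable_sqrt_pow_mul hν n 0

theorem negDiff_iterate_sqrtMoment (hν : ν (Icc (0 : ℝ) 1)ᶜ = 0) (j n : ℕ) :
    negDiff^[j] (sqrtMoment ν) n = ∫ x, √x ^ n * (1 - √x) ^ j / (1 + √x) ∂ν := by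
  induction j generalizing n with
  | zero => simp [sqrtMoment]
  | succ j ih =>
    rw [Function.iterate_succ_apply', negDiff, ih, ih,
      ← integral_sub (integrable_sqrt_pow_mul hν _ _) (integrable_sqrt_pow_mul hν _ _)]
    exact integral_congr_ae (.of_forall fun x => by ring)

theorem isCompletelyMonotone_sqrtMoment (hν : ν (Icc (0 : ℝ) 1)ᶜ = 0) :
    IsCompletelyMonotone (sqrtMoment ν) := fun j n => by
  rw [negDiff_iterate_sqrtMoment hν]
  refine integral_nonneg_of_ae ?_
  filter_upwards [ae_mem_of_measure_compl_eq_zero hν] with x hx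
  have h1 := sub_nonneg.2 (Real.sqrt_le_one.2 hx.2)
  simp only [Pi.zero_apply]
  positivity

theorem antitone_sqrtMoment (hν : ν (Icc (0 : ℝ) 1)ᶜ = 0) : Antitone (sqrtMoment ν) :=
  antitone_nat_of_succ_le fun n => sub_nonneg.1 (isCompletelyMonotone_sqrtMoment hν 1 n)

theorem sqrtMoment_zero_pos (hν : ν (Icc (0 : ℝ) 1)ᶜ = 0) (h : ν ≠ 0) : 0 < sqrtMoment ν 0 := by
  have h1 : ∫ _, (1 / 2 : ℝ) ∂ν ≤ sqrtMoment ν 0 := by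
    refine integral_mono_ae (integrable_const _) (integrable_sqrt_pow hν 0) ?_
    filter_upwards [ae_mem_of_measure_compl_eq_zero hν] with x hx
    have := Real.sqrt_le_one.2 hx.2
    rw [pow_zero]
    exact one_div_le_one_div_of_le (by positivity) (by linarith)
  have h2 : 0 < ν.real univ := by
    rw [measureReal_def]
    exact ENNReal.toReal_pos (Measure.measure_univ_ne_zero.2 h) (measure_ne_top _ _)
  simp only [integral_const, smul_eq_mul] at h1
  linarith

theorem sum_sqrtMoment_odd (hν : ν (Icc (0 : ℝ) 1)ᶜ = 0) (n : ℕ) :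
    ∑ k ∈ Finset.range (2 * n), sqrtMoment ν k = ∑ k ∈ Finset.range n, ∫ x, x ^ k ∂ν := by
  induction n with
  | zero => simp
  | succ n ih =>
    rw [mul_add, mul_one, Finset.sum_range_succ, Finset.sum_range_succ, ih,
      Finset.sum_range_succ _ n, add_assoc]
    congr 1
    rw [sqrtMoment, sqrtMoment,
      ← integral_add (integrable_sqrt_pow hν _) (integrable_sqrt_pow hν _)]
    refine integral_congr_ae ?_
    filter_upwards [ae_mem_of_measure_compl_eq_zero hν] with x hx
    have h0 : 1 + √x ≠ 0 := by positivity
    have h1 : x ^ n = √x ^ (2 * n) := by rw [pow_mul, Real.sq_sqrt hx.1]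
    rw [h1]
    field_simp
    ring

end

/-- Cut the sum into `M` blocks of length `m`; the first block dominates each of them. -/
theorem Antitone.sum_range_mul_le {f : ℕ → ℝ} (hf : Antitone f) (M m : ℕ) :
    ∑ k ∈ Finset.range (M * m), f k ≤ M * ∑ k ∈ Finset.range m, f k := by
  induction M with
  | zero => simp
  | succ M ih =>
    rw [add_mul, one_mul, Finset.sum_range_add]
    have : ∑ x ∈ Finset.range m, f (M * m + x) ≤ ∑ x ∈ Finset.range m, f x :=
      Finset.sum_le_sum fun x _ => hf (Nat.le_add_left _ _)
    push_cast
    linarith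

/-- Expanding `1 / (1 - r)` geometrically, the divergent integral is the sum of all moments; the
convention `0⁻¹ = ∞` covers an atom at `1`. -/
theorem exists_lt_sum_integral_pow {ν : Measure ℝ} [IsFiniteMeasure ν]
    (hν : ν (Icc (0 : ℝ) 1)ᶜ = 0) (hdiv : ∫⁻ r, (ENNReal.ofReal (1 - r))⁻¹ ∂ν = ∞) (K : ℝ) :
    ∃ n, K < ∑ k ∈ Finset.range n, ∫ x, x ^ k ∂ν := by
  by_contra! hK
  have hae := ae_mem_of_measure_compl_eq_zero hν
  have h1 : ∫⁻ r, (ENNReal.ofReal (1 - r))⁻¹ ∂ν = ∑' k : ℕ, ENNReal.ofReal (∫ x, x ^ k ∂ν) := by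
    calc ∫⁻ r, (ENNReal.ofReal (1 - r))⁻¹ ∂ν = ∫⁻ r, ∑' k : ℕ, ENNReal.ofReal (r ^ k) ∂ν := by
          refine lintegral_congr_ae ?_
          filter_upwards [hae] with x hx
          simp_rw [ENNReal.ofReal_pow hx.1]
          rw [ENNReal.tsum_geometric, ENNReal.ofReal_sub _ hx.1, ENNReal.ofReal_one]
      _ = ∑' k : ℕ, ∫⁻ r, ENNReal.ofReal (r ^ k) ∂ν :=
          lintegral_tsum fun k => by fun_prop
      _ = _ := by
          refine tsum_congr fun k => ?_
          rw [ofReal_integral_eq_lintegral_ofReal]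
          · refine Integrable.of_bound (by fun_prop) 1 ?_
            filter_upwards [hae] with x hx
            rw [norm_pow, Real.norm_of_nonneg hx.1]
            exact pow_le_one₀ hx.1 hx.2
          · filter_upwards [hae] with x hx
            exact pow_nonneg hx.1 k
  rw [h1] at hdiv
  have h2 : ∑' k : ℕ, ENNReal.ofReal (∫ x, x ^ k ∂ν) ≤ ENNReal.ofReal K := by
    refine ENNReal.tsum_le_of_sum_range_le fun n => ?_
    rw [← ENNReal.ofReal_sum_of_nonneg]
    · exact ENNReal.ofReal_le_ofReal (hK n)
    · intro k _
      refine integral_nonneg_of_ae ?_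
      filter_upwards [hae] with x hx
      exact pow_nonneg hx.1 k
  rw [hdiv] at h2
  exact ENNReal.ofReal_ne_top (top_le_iff.1 h2)

/-- A measure on `[0, 1]` whose moments are not bounded away from zero does not charge the point `1`. -/
theorem measure_compl_Ico_eq_zero_of_moments {μ : Measure ℝ} [IsFiniteMeasure μ]
    (h : μ (Icc (0 : ℝ) 1)ᶜ = 0) (hlim : ∀ ε > 0, ∃ n : ℕ, ∫ x, x ^ n ∂μ < ε) :
    μ (Ico (0 : ℝ) 1)ᶜ = 0 := by
  have h1 : μ {1} = 0 := by
    by_contra hne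
    obtain ⟨n, hn⟩ := hlim (μ.real {1}) (ENNReal.toReal_pos hne (measure_ne_top _ _))
    refine hn.not_ge ?_
    -- An atom at `1` contributes its full mass to every moment.
    rw [← integral_indicator_one (measurableSet_singleton _)]
    refine integral_mono_ae ((integrable_const (1 : ℝ)).indicator (measurableSet_singleton _)) ?_ ?_
    · refine Integrable.of_bound (by fun_prop) 1 ?_
      filter_upwards [ae_mem_of_measure_compl_eq_zero h] with x hx
      rw [norm_pow, Real.norm_of_nonneg hx.1]
      exact pow_le_one₀ hx.1 hx.2
    · filter_upwards [ae_mem_of_measure_compl_eq_zero h] with x hx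
      by_cases hx1 : x = 1
      · simp [hx1]
      · simpa [hx1] using pow_nonneg hx.1 n
  refine measure_mono_null (t := (Icc (0 : ℝ) 1)ᶜ ∪ {1}) ?_ (measure_union_null h h1)
  intro x hx
  simp only [mem_compl_iff, mem_Ico, mem_union, mem_Icc, mem_singleton_iff] at hx ⊢
  by_contra! hc
  exact hx ⟨hc.1.1, lt_of_le_of_ne hc.1.2 hc.2⟩

/-- The radial weight whose odd moments are the reciprocals of the partial sums of the moments
of `ν`. -/
theorem exists_doublingMeasure_moments {ν : Measure ℝ} [IsFiniteMeasure ν]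
    (hν : ν (Icc (0 : ℝ) 1)ᶜ = 0) (hdiv : ∫⁻ r, (ENNReal.ofReal (1 - r))⁻¹ ∂ν = ∞) :
    ∃ ω ∈ RadialBergman.doublingMeasures, ∀ n : ℕ,
      2 * Real.pi * (∫ x, x ^ (2 * n + 1) ∂ω) *
        ∑ k ∈ Finset.range (n + 1), ∫ x, x ^ k ∂ν = 1 := by
  have hν0 : ν ≠ 0 := by
    rintro rfl
    simp at hdiv
  have hcm := isCompletelyMonotone_sqrtMoment hν
  let a : ℕ → ℝ := fun n => ∑ k ∈ Finset.range (n + 1), sqrtMoment ν k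
  have ha : ∀ n, 0 < a n := fun n => by
    refine (sqrtMoment_zero_pos hν hν0).trans_le ?_
    exact Finset.single_le_sum (f := sqrtMoment ν) (fun k _ => hcm 0 k) (by simp)
  have hodd : ∀ n, a (2 * n + 1) = ∑ k ∈ Finset.range (n + 1), ∫ x, x ^ k ∂ν := fun n =>
    sum_sqrtMoment_odd hν (n + 1)
  have hinc : (fun n => a (n + 1) - a n) = fun n => sqrtMoment ν (n + 1) := by
    ext n
    simp only [a]
    rw [Finset.sum_range_succ _ (n + 1)]
    ring
  have hb : IsCompletelyMonotone a⁻¹ := by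
    refine IsCompletelyMonotone.inv ha fun k n => ?_
    rw [hinc, negDiff_iterate_shift]
    exact hcm k (n + 1)
  obtain ⟨μ, hμ, hμI, hmom⟩ := hb.exists_measure_real
  have hμ1 : μ (Ico (0 : ℝ) 1)ᶜ = 0 := by
    refine measure_compl_Ico_eq_zero_of_moments hμI fun ε hε => ?_
    obtain ⟨n, hn⟩ := exists_lt_sum_integral_pow hν hdiv ε⁻¹
    rcases n with _ | n
    · exact absurd hn (by simpa using hε.le)
    refine ⟨2 * n + 1, ?_⟩
    rw [hmom, Pi.inv_apply, hodd]
    exact inv_lt_of_inv_lt₀ hε hn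
  have hpi := Real.pi_pos
  have hω : ∀ n : ℕ, ∫ x, x ^ n ∂(ENNReal.ofReal (2 * Real.pi)⁻¹ • μ) =
      (2 * Real.pi)⁻¹ * (a n)⁻¹ := fun n => by
    rw [integral_smul_measure, hmom, ENNReal.toReal_ofReal (by positivity)]
    rfl
  have := Measure.smul_finite μ (ENNReal.ofReal_ne_top (r := (2 * Real.pi)⁻¹))
  refine ⟨ENNReal.ofReal (2 * Real.pi)⁻¹ • μ, mem_doublingMeasures_of_moments ?_ fun k => ?_,
    fun n => ?_⟩
  · simp [hμ1]
  · rw [hω, hω, mul_left_comm]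
    refine mul_le_mul_of_nonneg_left ?_ (by positivity)
    -- `a m` has `m + 1` terms, so index `20 k + 19` means exactly `20 (k + 1)` terms.
    have h1 : a (20 * k + 19) ≤ 20 * a k := by
      simpa [mul_add] using (antitone_sqrtMoment hν).sum_range_mul_le 20 (k + 1)
    rw [← div_eq_mul_inv, le_div_iff₀ (ha _), ← div_eq_inv_mul, div_le_iff₀ (ha _)]
    exact h1
  · rw [hω, ← hodd]
    have := (ha (2 * n + 1)).ne'
    field_simp

/-! ### Reproducing kernels of radial weights. -/

section

variable {ω : Measure ℝ} [IsFiniteMeasure ω]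

theorem isFiniteMeasure_withDensity_of_measure_compl_Ico (hω : ω (Ico (0 : ℝ) 1)ᶜ = 0) :
    IsFiniteMeasure (ω.withDensity fun r => ENNReal.ofReal r) := by
  refine isFiniteMeasure_withDensity (ne_top_of_le_ne_top (measure_ne_top ω univ) ?_)
  rw [← lintegral_one]
  refine lintegral_mono_ae ?_
  filter_upwards [ae_mem_of_measure_compl_eq_zero hω] with r hr
  exact ENNReal.ofReal_le_one.2 hr.2.le

theorem isFiniteMeasure_discMeasure (hω : ω (Ico (0 : ℝ) 1)ᶜ = 0) :
    IsFiniteMeasure (RadialBergman.discMeasure ω) := by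
  have := isFiniteMeasure_withDensity_of_measure_compl_Ico hω
  unfold RadialBergman.discMeasure
  infer_instance

/-- Integration over the disc in polar coordinates. -/
theorem setIntegral_ball_discMeasure (hω : ω (Ico (0 : ℝ) 1)ᶜ = 0) {g : ℂ → ℂ}
    (hg : IntegrableOn g (Metric.ball 0 1) (RadialBergman.discMeasure ω)) :
    ∫ ζ in Metric.ball (0 : ℂ) 1, g ζ ∂(RadialBergman.discMeasure ω) =
      ∫ r : ℝ, r • (∫ θ in (0 : ℝ)..2 * Real.pi, g (r * Complex.exp ((θ : ℂ) * Complex.I))) ∂ω := by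
  have := isFiniteMeasure_withDensity_of_measure_compl_Ico hω
  have hpolar : Measurable fun p : ℝ × ℝ => (p.1 : ℂ) * Complex.exp ((p.2 : ℂ) * Complex.I) := by
    fun_prop
  have hG := hg.integrable_indicator Metric.isOpen_ball.measurableSet
  rw [← integral_indicator Metric.isOpen_ball.measurableSet]
  have hG' := hG
  rw [RadialBergman.discMeasure] at hG'
  rw [RadialBergman.discMeasure, integral_map hpolar.aemeasurable hG'.1,
    integral_prod (fun p : ℝ × ℝ => (Metric.ball 0 1).indicator g
      ((p.1 : ℂ) * Complex.exp ((p.2 : ℂ) * Complex.I)))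
      ((integrable_map_measure hG'.1 hpolar.aemeasurable).1 hG'),
    integral_withDensity_eq_integral_toReal_smul (by fun_prop)
      (.of_forall fun _ => ENNReal.ofReal_lt_top)]
  refine integral_congr_ae ?_
  filter_upwards [ae_mem_of_measure_compl_eq_zero hω] with r hr
  rw [ENNReal.toReal_ofReal hr.1, intervalIntegral.integral_of_le (by positivity)]
  congr 1
  refine integral_congr_ae (.of_forall fun θ => ?_)
  refine indicator_of_mem ?_ g
  simpa [Complex.norm_exp_ofReal_mul_I, abs_of_nonneg hr.1] using hr.2

end

/-- The Taylor coefficients on the unit disc, as integrals over circles. -/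
theorem intervalIntegral_mul_conj_pow {f : ℂ → ℂ} (hf : DifferentiableOn ℂ f (Metric.ball 0 1))
    {r : ℝ} (hr0 : 0 < r) (hr1 : r < 1) (n : ℕ) :
    ∫ θ in (0 : ℝ)..2 * Real.pi, f (r * Complex.exp (θ * Complex.I)) *
        conj (r * Complex.exp (θ * Complex.I)) ^ n =
      2 * Real.pi * (iteratedDeriv n f 0 / n.factorial) * r ^ (2 * n) := by
  have hC := (hf.mono (Metric.closedBall_subset_ball hr1)).circleIntegral_one_div_sub_center_pow_smul
    hr0 n
  rw [circleIntegral] at hC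
  -- On `|z| = r` one has `1 / z = conj z / r^2`, so `dz / z^(n+1) = i (conj z)^n / r^(2n) dθ`.
  have hI : ∀ θ : ℝ, deriv (circleMap 0 r) θ •
      ((1 / (circleMap 0 r θ - 0) ^ (n + 1)) • f (circleMap 0 r θ)) =
      (Complex.I / r ^ (2 * n)) * (f (r * Complex.exp (θ * Complex.I)) *
        conj (r * Complex.exp (θ * Complex.I)) ^ n) := fun θ => by
    have hz : circleMap 0 r θ ≠ 0 := circleMap_ne_center hr0.ne'
    have hcz : circleMap 0 r θ = r * Complex.exp (θ * Complex.I) := by simp [circleMap]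
    have hr : ((r : ℂ)) ^ (2 * n) = circleMap 0 r θ ^ n * conj (circleMap 0 r θ) ^ n := by
      rw [← mul_pow, Complex.mul_conj, Complex.normSq_eq_norm_sq, norm_circleMap_zero, sq_abs,
        pow_mul]
      push_cast
      rfl
    have hcz0 : conj (circleMap 0 r θ) ≠ 0 := (map_ne_zero _).2 hz
    rw [← hcz, hr, deriv_circleMap, sub_zero]
    simp only [smul_eq_mul]
    field_simp
    ring
  simp_rw [hI] at hC
  rw [intervalIntegral.integral_const_mul] at hC
  have hr : (r : ℂ) ≠ 0 := mod_cast hr0.ne'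
  have hfac : (n.factorial : ℂ) ≠ 0 := mod_cast n.factorial_ne_zero
  have hI0 := Complex.I_ne_zero
  rw [smul_eq_mul] at hC
  field_simp at hC ⊢
  linear_combination hC

section

variable {ω : Measure ℝ} [IsFiniteMeasure ω]

theorem setIntegral_ball_mul_conj_pow (hω : ω (Ico (0 : ℝ) 1)ᶜ = 0) {f : ℂ → ℂ}
    (hf : DifferentiableOn ℂ f (Metric.ball 0 1)) (n : ℕ)
    (hint : IntegrableOn (fun ζ => f ζ * conj ζ ^ n) (Metric.ball 0 1)
      (RadialBergman.discMeasure ω)) :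
    ∫ ζ in Metric.ball (0 : ℂ) 1, f ζ * conj ζ ^ n ∂(RadialBergman.discMeasure ω) =
      (iteratedDeriv n f 0 / n.factorial) *
        ((2 * Real.pi * ∫ x, x ^ (2 * n + 1) ∂ω : ℝ) : ℂ) := by
  rw [setIntegral_ball_discMeasure hω hint, Complex.ofReal_mul, ← integral_complex_ofReal,
    ← integral_const_mul, ← integral_const_mul]
  refine integral_congr_ae ?_
  filter_upwards [ae_mem_of_measure_compl_eq_zero hω] with r hr
  rcases hr.1.eq_or_lt with rfl | h0
  · simp
  · rw [intervalIntegral_mul_conj_pow hf h0 hr.2 n, Complex.real_smul]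
    push_cast
    ring

theorem integrableOn_of_mem_bergmanSpace (hω : ω (Ico (0 : ℝ) 1)ᶜ = 0) {f : ℂ → ℂ}
    (hf : f ∈ RadialBergman.bergmanSpace 2 ω) :
    IntegrableOn f (Metric.ball 0 1) (RadialBergman.discMeasure ω) := by
  have := isFiniteMeasure_discMeasure hω
  have h2 : MemLp f 2 ((RadialBergman.discMeasure ω).restrict (Metric.ball 0 1)) := by
    refine ⟨hf.1.continuousOn.aestronglyMeasurable Metric.isOpen_ball.measurableSet, ?_⟩
    rw [eLpNorm_lt_top_iff_lintegral_rpow_enorm_lt_top two_ne_zero ENNReal.ofNat_ne_top]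
    exact hf.2
  exact h2.integrable one_le_two

theorem norm_mul_pow_le {β : ℝ} (hβ : 0 ≤ β) (z : ℂ) {ζ : ℂ} (hζ : ζ ∈ Metric.ball (0 : ℂ) 1)
    (n : ℕ) : ‖(β : ℂ) * (conj z * ζ) ^ n‖ ≤ β * ‖z‖ ^ n := by
  rw [norm_mul, Complex.norm_real, Real.norm_of_nonneg hβ, norm_pow, norm_mul, RCLike.norm_conj]
  have : ‖z‖ * ‖ζ‖ ≤ ‖z‖ :=
    mul_le_of_le_one_right (norm_nonneg _) (mem_ball_zero_iff.1 hζ).le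
  gcongr

theorem tsum_mem_bergmanSpace (hω : ω (Ico (0 : ℝ) 1)ᶜ = 0) {β : ℕ → ℝ} (hβ : ∀ n, 0 ≤ β n)
    {z : ℂ} (hsum : Summable fun n => β n * ‖z‖ ^ n) :
    (fun ζ => ∑' n : ℕ, (β n : ℂ) * (conj z * ζ) ^ n) ∈ RadialBergman.bergmanSpace 2 ω := by
  have := isFiniteMeasure_discMeasure hω
  refine ⟨Complex.differentiableOn_tsum_of_summable_norm hsum (fun n => by fun_prop)
    Metric.isOpen_ball fun n ζ hζ => norm_mul_pow_le (hβ n) z hζ n, ?_⟩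
  have hle : ∀ ζ ∈ Metric.ball (0 : ℂ) 1,
      ‖∑' n : ℕ, (β n : ℂ) * (conj z * ζ) ^ n‖ₑ ^ (2 : ℝ) ≤
        ENNReal.ofReal (∑' n, β n * ‖z‖ ^ n) ^ (2 : ℝ) := fun ζ hζ => by
    refine ENNReal.rpow_le_rpow ?_ zero_le_two
    rw [← ofReal_norm]
    exact ENNReal.ofReal_le_ofReal
      (tsum_of_norm_bounded hsum.hasSum fun n => norm_mul_pow_le (hβ n) z hζ n)
  refine (setLIntegral_mono' Metric.isOpen_ball.measurableSet hle).trans_lt ?_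
  rw [setLIntegral_const]
  exact ENNReal.mul_lt_top (by simp) (measure_lt_top _ _)

/-- The reproducing kernel of a radial weight is a power series whose coefficients are the
reciprocals of the odd moments. -/
theorem isBergmanKernel_tsum (hω : ω (Ico (0 : ℝ) 1)ᶜ = 0) {β : ℕ → ℝ} (hβ : ∀ n, 0 ≤ β n)
    (hmom : ∀ n, 2 * Real.pi * (∫ x, x ^ (2 * n + 1) ∂ω) * β n = 1)
    (hsum : ∀ z ∈ Metric.ball (0 : ℂ) 1, Summable fun n => β n * ‖z‖ ^ n) :
    RadialBergman.IsBergmanKernel ω fun z ζ => ∑' n : ℕ, (β n : ℂ) * (conj z * ζ) ^ n := by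
  intro z hz
  refine ⟨tsum_mem_bergmanSpace hω hβ (hsum z hz), fun f hf => ?_⟩
  have hfi := integrableOn_of_mem_bergmanSpace hω hf
  have hball : MeasurableSet (Metric.ball (0 : ℂ) 1) := Metric.isOpen_ball.measurableSet
  have hbound : ∀ n, ∀ ζ ∈ Metric.ball (0 : ℂ) 1, ‖conj ζ ^ n‖ ≤ 1 := fun n ζ hζ => by
    rw [norm_pow, RCLike.norm_conj]
    exact pow_le_one₀ (norm_nonneg _) (mem_ball_zero_iff.1 hζ).le
  have hint : ∀ n : ℕ, IntegrableOn (fun ζ => f ζ * conj ζ ^ n) (Metric.ball 0 1)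
      (RadialBergman.discMeasure ω) := fun n => by
    refine Integrable.mul_bdd (c := 1) hfi
      (Continuous.aestronglyMeasurable (by fun_prop)) ?_
    exact (ae_restrict_mem hball).mono (hbound n)
  -- The terms of `f * conj (B z)`. They are integrated one by one, `f` being integrable and `|conj
  -- ζ ^ n| ≤ 1`; the `n`-th integral is the `n`-th Taylor term of `f` at `z`.
  let F : ℕ → ℂ → ℂ := fun n ζ => (β n * z ^ n : ℂ) * (f ζ * conj ζ ^ n)
  have hFi : ∀ n, IntegrableOn (F n) (Metric.ball 0 1) (RadialBergman.discMeasure ω) :=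
    fun n => (hint n).const_mul _
  have hFs : Summable fun n => ∫ ζ in Metric.ball (0 : ℂ) 1, ‖F n ζ‖
      ∂(RadialBergman.discMeasure ω) := by
    refine Summable.of_nonneg_of_le (fun n => integral_nonneg fun _ => norm_nonneg _) (fun n => ?_)
      ((hsum z hz).mul_right
        (∫ ζ in Metric.ball (0 : ℂ) 1, ‖f ζ‖ ∂(RadialBergman.discMeasure ω)))
    rw [← integral_const_mul]
    refine setIntegral_mono_on (hFi n).norm (hfi.norm.const_mul _) hball fun ζ hζ => ?_
    simp only [F]
    rw [norm_mul, norm_mul, norm_mul, Complex.norm_real, Real.norm_of_nonneg (hβ n), norm_pow]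
    refine mul_le_mul_of_nonneg_left (mul_le_of_le_one_right (norm_nonneg _) (hbound n ζ hζ)) ?_
    exact mul_nonneg (hβ n) (by positivity)
  have hS := hasSum_integral_of_summable_integral_norm hFi hFs
  have hval : ∀ n, ∫ ζ in Metric.ball (0 : ℂ) 1, F n ζ ∂(RadialBergman.discMeasure ω) =
      (n.factorial : ℂ)⁻¹ • (z - 0) ^ n • iteratedDeriv n f 0 := fun n => by
    have hm : ((2 * Real.pi * ∫ x, x ^ (2 * n + 1) ∂ω : ℝ) : ℂ) * β n = 1 := mod_cast hmom n
    simp only [F]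
    rw [integral_const_mul, setIntegral_ball_mul_conj_pow hω hf.1 n (hint n), sub_zero,
      smul_eq_mul, smul_eq_mul]
    linear_combination (z ^ n * (iteratedDeriv n f 0 / n.factorial)) * hm
  simp_rw [hval] at hS
  rw [(Complex.hasSum_taylorSeries_on_ball hf.1 hz).unique hS]
  refine setIntegral_congr_fun hball fun ζ _ => ?_
  simp only [F]
  rw [Complex.conj_tsum, ← tsum_mul_left]
  refine tsum_congr fun n => ?_
  simp only [map_mul, map_pow, Complex.conj_ofReal, Complex.conj_conj]
  ring

end

theorem RadialBergman.IsBergmanKernel.congr {ω : Measure ℝ} {B B' : ℂ → ℂ → ℂ}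
    (hB : RadialBergman.IsBergmanKernel ω B)
    (h : ∀ z ∈ Metric.ball (0 : ℂ) 1, ∀ ζ ∈ Metric.ball (0 : ℂ) 1, B' z ζ = B z ζ) :
    RadialBergman.IsBergmanKernel ω B' := by
  have hball : MeasurableSet (Metric.ball (0 : ℂ) 1) := Metric.isOpen_ball.measurableSet
  intro z hz
  obtain ⟨⟨hd, hi⟩, hrep⟩ := hB z hz
  refine ⟨⟨hd.congr (h z hz), ?_⟩, fun f hf => ?_⟩
  · rwa [setLIntegral_congr_fun hball fun ζ hζ => by rw [h z hz ζ hζ]]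
  · rw [hrep f hf]
    exact setIntegral_congr_fun hball fun ζ hζ => by simp only [h z hz ζ hζ]

/-! ### Power series of the prescribed kernel. -/

section

variable {ν : Measure ℝ} [IsFiniteMeasure ν]

theorem norm_ofReal_mul_pow_le {x : ℝ} (hx : x ∈ Icc (0 : ℝ) 1) (w : ℂ) (n : ℕ) :
    ‖((x : ℂ) * w) ^ n‖ ≤ ‖w‖ ^ n := by
  rw [norm_pow, norm_mul, Complex.norm_real, Real.norm_of_nonneg hx.1]
  exact pow_le_pow_left₀ (mul_nonneg hx.1 (norm_nonneg _))
    (mul_le_of_le_one_left (norm_nonneg _) hx.2) n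

theorem integral_pow_mem_Icc (hν : ν (Icc (0 : ℝ) 1)ᶜ = 0) (n : ℕ) :
    ∫ x, x ^ n ∂ν ∈ Icc 0 (ν.real univ) := by
  have hae := ae_mem_of_measure_compl_eq_zero hν
  constructor
  · refine integral_nonneg_of_ae ?_
    filter_upwards [hae] with x hx
    exact pow_nonneg hx.1 n
  · refine (Real.le_norm_self _).trans ((norm_integral_le_of_norm_le_const (C := (1 : ℝ)) ?_).trans_eq
      (one_mul _))
    filter_upwards [hae] with x hx
    rw [norm_pow, Real.norm_of_nonneg hx.1]
    exact pow_le_one₀ hx.1 hx.2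

theorem summable_sum_integral_pow_mul (hν : ν (Icc (0 : ℝ) 1)ᶜ = 0) {t : ℝ} (ht0 : 0 ≤ t)
    (ht1 : t < 1) :
    Summable fun n => (∑ k ∈ Finset.range (n + 1), ∫ x, x ^ k ∂ν) * t ^ n := by
  have h1 : Summable fun n : ℕ => ν.real univ * (((n : ℝ) ^ 1 * t ^ n) + t ^ n) :=
    ((summable_pow_mul_geometric_of_norm_lt_one 1
      (by rwa [Real.norm_of_nonneg ht0])).add (summable_geometric_of_lt_one ht0 ht1)).mul_left _
  refine Summable.of_nonneg_of_le (fun n => ?_) (fun n => ?_) h1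
  · exact mul_nonneg (Finset.sum_nonneg fun k _ => (integral_pow_mem_Icc hν k).1) (by positivity)
  · have := Finset.sum_le_card_nsmul (Finset.range (n + 1)) (fun k => ∫ x, x ^ k ∂ν) _
      fun k _ => (integral_pow_mem_Icc hν k).2
    rw [Finset.card_range, nsmul_eq_mul] at this
    refine (mul_le_mul_of_nonneg_right this (by positivity)).trans_eq ?_
    push_cast
    ring

theorem hasSum_integral_pow_mul_pow (hν : ν (Icc (0 : ℝ) 1)ᶜ = 0) {w : ℂ} (hw : ‖w‖ < 1) :
    HasSum (fun n : ℕ => ((∫ x, x ^ n ∂ν : ℝ) : ℂ) * w ^ n) (∫ x, 1 / (1 - (x : ℂ) * w) ∂ν) := by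
  have hae := ae_mem_of_measure_compl_eq_zero hν
  have hint : ∀ n : ℕ, Integrable (fun x : ℝ => ((x : ℂ) * w) ^ n) ν := fun n => by
    refine Integrable.of_bound (by fun_prop) (‖w‖ ^ n) ?_
    filter_upwards [hae] with x hx
    exact norm_ofReal_mul_pow_le hx w n
  have hs : Summable fun n : ℕ => ∫ x : ℝ, ‖((x : ℂ) * w) ^ n‖ ∂ν := by
    refine Summable.of_nonneg_of_le (fun n => integral_nonneg fun _ => norm_nonneg _) (fun n => ?_)
      ((summable_geometric_of_lt_one (norm_nonneg w) hw).mul_left (ν.real univ))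
    have := integral_mono_ae (hint n).norm (integrable_const (‖w‖ ^ n))
      (hae.mono fun x hx => norm_ofReal_mul_pow_le hx w n)
    rwa [integral_const, smul_eq_mul] at this
  have h := hasSum_integral_of_summable_integral_norm hint hs
  have e1 : ∀ n : ℕ, ∫ x : ℝ, ((x : ℂ) * w) ^ n ∂ν = ((∫ x, x ^ n ∂ν : ℝ) : ℂ) * w ^ n := by
    intro n
    rw [← integral_complex_ofReal, ← integral_mul_const]
    exact integral_congr_ae (.of_forall fun x => by push_cast; ring)
  have e2 : ∫ x : ℝ, ∑' n : ℕ, ((x : ℂ) * w) ^ n ∂ν = ∫ x, 1 / (1 - (x : ℂ) * w) ∂ν := by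
    refine integral_congr_ae ?_
    filter_upwards [hae] with x hx
    rw [tsum_geometric_of_norm_lt_one, one_div]
    have := norm_ofReal_mul_pow_le hx w 1
    simp only [pow_one] at this
    exact this.trans_lt hw
  simp_rw [e1, e2] at h
  exact h

/-- Cauchy product of the moment series with the geometric series: multiplying by `1 / (1 - w)`
turns coefficients into partial sums. -/
theorem one_div_mul_integral_eq_tsum (hν : ν (Icc (0 : ℝ) 1)ᶜ = 0) {w : ℂ} (hw : ‖w‖ < 1) :
    1 / (1 - w) * ∫ x, 1 / (1 - (x : ℂ) * w) ∂ν =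
      ∑' n : ℕ, ((∑ k ∈ Finset.range (n + 1), ∫ x, x ^ k ∂ν : ℝ) : ℂ) * w ^ n := by
  have h := hasSum_integral_pow_mul_pow hν hw
  rw [← h.tsum_eq, one_div, ← tsum_geometric_of_norm_lt_one hw, mul_comm,
    tsum_mul_tsum_eq_tsum_sum_range_of_summable_norm h.summable.norm
      (summable_norm_geometric_of_norm_lt_one hw)]
  refine tsum_congr fun n => ?_
  rw [Complex.ofReal_sum, Finset.sum_mul]
  refine Finset.sum_congr rfl fun k hk => ?_
  rw [mul_assoc, ← pow_add, Nat.add_sub_cancel' (Nat.le_of_lt_succ (Finset.mem_range.1 hk))]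

end

theorem theorem1 (ν : Measure ℝ) [IsFiniteMeasure ν]
    (hsupp : ν (Icc (0 : ℝ) 1)ᶜ = 0)
    (hdiv : ∫⁻ r in Icc (0 : ℝ) 1, (ENNReal.ofReal (1 - r))⁻¹ ∂ν = ∞) :
    ∃ ω ∈ RadialBergman.doublingMeasures,
      RadialBergman.IsBergmanKernel ω (fun z ζ =>
        1 / (1 - conj z * ζ) *
          ∫ r in Icc (0 : ℝ) 1, 1 / (1 - (r : ℂ) * conj z * ζ) ∂ν) := by
  rw [Measure.restrict_eq_self_of_ae_mem (ae_mem_of_measure_compl_eq_zero hsupp)] at *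
  obtain ⟨ω, hω, hmom⟩ := exists_doublingMeasure_moments hsupp hdiv
  refine ⟨ω, hω, ?_⟩
  have := hω.1
  refine (isBergmanKernel_tsum hω.2.1
    (fun n => Finset.sum_nonneg fun k _ => (integral_pow_mem_Icc hsupp k).1) hmom
    fun z hz => summable_sum_integral_pow_mul hsupp (norm_nonneg z)
      (mem_ball_zero_iff.1 hz)).congr fun z hz ζ hζ => ?_
  simp_rw [mul_assoc _ (conj z)]
  refine one_div_mul_integral_eq_tsum hsupp ?_
  rw [norm_mul, RCLike.norm_conj]
  exact mul_lt_one_of_nonneg_of_lt_one_left (norm_nonneg _) (mem_ball_zero_iff.1 hz)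
    (mem_ball_zero_iff.1 hζ).le
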